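/- Let $\gamma\in\mathbb R$ and $L>0$. A trajectory driven by a continuous control $n:[0,L]\to\mathbb C$ is a function $q:[0,L]\to\mathbb C$ with $$q'(z)=i\gamma|q(z)|^2q(z)+n(z),\qquad 0\le z\le L,$$ (one-sided derivatives at the end points); its effort is $\int_0^L|n(z)|^2\,dz$. For $x\in\mathbb C$ and $E\in\mathbb R$ let $B_E(x)$ be the set of all points $q(L)$, where $q$ is a trajectory with $q(0)=x$ and effort at most $E$, and let $$d(x_1,x_2)=\inf\{E : B_E(x_1)\cap B_E(x_2)\neq\varnothing\}.$$ Let $x_1,x_2\in\mathbb C$, and let $q_k=a_k+ib_k$ ($k=1,2$, $a_k,b_k$ real) be trajectories driven by continuous controls $n_1,n_2$ with $q_1(0)=x_1$, $q_2(0)=x_2$, $q_1(L)=q_2(L)$ and equal efforts, whose common effort is the minimum $$\int_0^L|n_1|^2\,dz=\int_0^L|n_2|^2\,dz=d(x_1,x_2)$$ (equivalently, it is minimal among all pairs of trajectories satisfying these constraints). Put $g_k(a_k,b_k,a_k',b_k')=\left|a_k'+ib_k'-i\gamma(a_k^2+b_k^2)(a_k+ib_k)\right|^2$. Then $a_1,b_1,a_2,b_2$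 are twice continuously differentiable on $[0,L]$, and there are a constant $\lambda\in\mathbb R$ and a differentiable function $c:[0,L]\to\mathbb R$ such that on $[0,L]$ $$(1-\lambda)\left(-4\gamma b_1'(a_1^2+b_1^2)+3\gamma^2a_1(a_1^2+b_1^2)^2-a_1''\right)=0,$$ $$(1-\lambda)\left(4\gamma a_1'(a_1^2+b_1^2)+3\gamma^2b_1(a_1^2+b_1^2)^2-b_1''\right)=0,$$ $$\lambda\left(-4\gamma b_2'(a_2^2+b_2^2)+3\gamma^2a_2(a_2^2+b_2^2)^2-a_2''\right)=0,$$ $$\lambda\left(4\gamma a_2'(a_2^2+b_2^2)+3\gamma^2b_2(a_2^2+b_2^2)^2-b_2''\right)=0,$$ $$c'+g_1(a_1,b_1,a_1',b_1')-g_2(a_2,b_2,a_2',b_2')=0,$$ together with the boundary conditions at $z=0$ $$a_k(0)+ib_k(0)=x_k\ (k=1,2),\qquad c(0)=0,$$ and at $z=L$ $$c(L)=0,\qquad a_1(L)+ib_1(L)=a_2(L)+ib_2(L),$$ $$(1-\lambda)a_1'(L)+\lambda a_2'(L)+\gamma b_1(L)\left(a_1^2(L)+b_1^2(L)\right)=0,$$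 $$(1-\lambda)b_1'(L)+\lambda b_2'(L)-\gamma a_1(L)\left(a_1^2(L)+b_1^2(L)\right)=0.$$ -/

import Mathlib

open Set

noncomputable section

/-- `q` is a trajectory on `[0, L]` of the control system `q' = i γ |q|² q + n` driven by a
continuous control `n` (one-sided derivatives at the end points). Only the values on `[0, L]`
matter. -/
def IsTrajectory (γ L : ℝ) (n q : ℝ → ℂ) : Prop :=
  ContinuousOn n (Icc 0 L) ∧
    ∀ z ∈ Icc 0 L,
      HasDerivWithinAt q (Complex.I * γ * (‖q z‖ : ℂ) ^ 2 * q z + n z) (Icc 0 L) z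

/-- The effort (energy) `∫₀ᴸ |n(z)|² dz` of a control. -/
def effort (L : ℝ) (n : ℝ → ℂ) : ℝ := ∫ z in (0 : ℝ)..L, ‖n z‖ ^ 2

/-- `S_E(x)`: the outputs reachable from the input `x` with effort exactly `E`. -/
def reachExact (γ L E : ℝ) (x : ℂ) : Set ℂ :=
  {y | ∃ n q : ℝ → ℂ, IsTrajectory γ L n q ∧ q 0 = x ∧ q L = y ∧ effort L n = E}

/-- `B_E(x)`: the noise ball, the outputs reachable from `x` with effort at most `E`. -/
def noiseBall (γ L E : ℝ) (x : ℂ) : Set ℂ := ⋃ ε ≤ E, reachExact γ L ε x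

/-- The adversarial distance `d(x₁, x₂) = inf {E | B_E(x₁) ∩ B_E(x₂) ≠ ∅}`. -/
def adversarialDistance (γ L : ℝ) (x₁ x₂ : ℂ) : ℝ :=
  sInf {E | (noiseBall γ L E x₁ ∩ noiseBall γ L E x₂).Nonempty}

/-- The constraints of the equal-energy confusion problem: the controls `n₁, n₂` drive `x₁, x₂`
along `q₁, q₂` to the same output with the same effort. -/
structure IsConfusingPair (γ L : ℝ) (x₁ x₂ : ℂ) (n₁ q₁ n₂ q₂ : ℝ → ℂ) : Prop where
  traj₁ : IsTrajectory γ L n₁ q₁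
  traj₂ : IsTrajectory γ L n₂ q₂
  start₁ : q₁ 0 = x₁
  start₂ : q₂ 0 = x₂
  same_output : q₁ L = q₂ L
  same_effort : effort L n₁ = effort L n₂

/-- The trajectories `q₁, q₂` are optimal: they satisfy the constraints of the equal-energy
confusion problem, and their common effort attains the infimum `d(x₁, x₂)`. By
`isOptimalPair_iff` below, this is the same as minimality among all equal-energy pairs. -/
def IsOptimalPair (γ L : ℝ) (x₁ x₂ : ℂ) (q₁ q₂ : ℝ → ℂ) : Prop :=
  ∃ n₁ n₂ : ℝ → ℂ, IsConfusingPair γ L x₁ x₂ n₁ q₁ n₂ q₂ ∧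
    effort L n₁ = adversarialDistance γ L x₁ x₂

/-- The Lagrangian `g(a, b, a', b') = |a' + i b' - i γ (a² + b²) (a + i b)|²`. -/
def effortDensity (γ a b a' b' : ℝ) : ℝ :=
  ‖(a' : ℂ) + Complex.I * b' - Complex.I * γ * ((a : ℂ) ^ 2 + (b : ℂ) ^ 2) * (a + Complex.I * b)‖ ^ 2

/-- The derivative on `[0, L]`, one-sided at the end points. -/
def segDeriv (L : ℝ) (f : ℝ → ℝ) : ℝ → ℝ := derivWithin f (Icc 0 L)

/-! ### The distance is the value of the equal-energy problem -/

theorem effort_nonneg {L : ℝ} (hL : 0 < L) (n : ℝ → ℂ) : 0 ≤ effort L n :=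
  intervalIntegral.integral_nonneg hL.le (fun _ _ => by positivity)

theorem IsTrajectory.continuousOn {γ L : ℝ} {n q : ℝ → ℂ} (h : IsTrajectory γ L n q) :
    ContinuousOn q (Icc 0 L) := fun z hz => (h.2 z hz).continuousWithinAt

/-- Any larger effort is also exactly realised between the same end points. -/
theorem reachExact_inflate {γ L : ℝ} (hL : 0 < L) {ε E : ℝ} (hε : ε ≤ E) {x y : ℂ}
    (h : y ∈ reachExact γ L ε x) : y ∈ reachExact γ L E x := by
  obtain ⟨n, q, hq, h0, h1, he⟩ := h
  have hε0 : 0 ≤ ε := he ▸ effort_nonneg hL n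
  have hφ : ∀ z : ℝ, HasDerivWithinAt (fun z : ℝ => z * (L - z)) (L - 2 * z) (Icc 0 L) z := by
    intro z
    have := ((hasDerivAt_id' z).mul ((hasDerivAt_const z L).sub (hasDerivAt_id' z)))
    exact (this.congr_deriv (by simp only [Pi.sub_apply]; ring)).hasDerivWithinAt
  have hφc : ∀ z : ℝ, HasDerivWithinAt (fun z : ℝ => ((z * (L - z) : ℝ) : ℂ))
      ((L - 2 * z : ℝ) : ℂ) (Icc 0 L) z := fun z => (hφ z).ofReal_comp
  have hu : uIcc 0 L = Icc 0 L := uIcc_of_le hL.le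
  have hI : ∀ f : ℝ → ℝ, ContinuousOn f (Icc 0 L) →
      IntervalIntegrable f MeasureTheory.volume 0 L := fun f hf =>
    ContinuousOn.intervalIntegrable (by rwa [hu])
  -- a family of trajectories with polynomially growing effort suffices
  by_cases hcase : ∃ z ∈ Icc 0 L, (L - 2 * z) ^ 2 * ‖q z‖ ^ 2 ≠ 0
  · obtain ⟨z₀, hz₀, hne⟩ := hcase
    set B : ℝ := ∫ z in (0 : ℝ)..L, (L - 2 * z) * (2 * (n z * star (Complex.I * q z)).re)
    set A : ℝ := ∫ z in (0 : ℝ)..L, (L - 2 * z) ^ 2 * ‖q z‖ ^ 2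
    have hqc := hq.continuousOn
    have hnc := hq.1
    have cA : ContinuousOn (fun z : ℝ => (L - 2 * z) ^ 2 * ‖q z‖ ^ 2) (Icc 0 L) := by fun_prop
    have cB : ContinuousOn
        (fun z : ℝ => (L - 2 * z) * (2 * (n z * star (Complex.I * q z)).re)) (Icc 0 L) := by
      have : ContinuousOn (fun z : ℝ => (n z * star (Complex.I * q z)).re) (Icc 0 L) :=
        Complex.continuous_re.comp_continuousOn
          (hnc.mul (continuous_star.comp_continuousOn (continuousOn_const.mul hqc)))
      fun_prop
    have hA : 0 < A := intervalIntegral.integral_pos hL cA (fun _ _ => by positivity)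
      ⟨z₀, hz₀, lt_of_le_of_ne (by positivity) (Ne.symm hne)⟩
    have key : ∀ s : ℝ, y ∈ reachExact γ L (ε + s * B + s ^ 2 * A) x := by
      intro s
      refine ⟨fun z => Complex.exp (((s * (z * (L - z)) : ℝ) : ℂ) * Complex.I) *
          (n z + ((s * (L - 2 * z) : ℝ) : ℂ) * (Complex.I * q z)),
        fun z => Complex.exp (((s * (z * (L - z)) : ℝ) : ℂ) * Complex.I) * q z,
        ⟨?_, ?_⟩, ?_, ?_, ?_⟩
      · fun_prop
      · intro z hz
        have h1 : HasDerivWithinAt (fun z : ℝ => (((s * (z * (L - z)) : ℝ) : ℂ) * Complex.I))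
            (((s * (L - 2 * z) : ℝ) : ℂ) * Complex.I) (Icc 0 L) z :=
          (((hφ z).const_mul s).ofReal_comp).mul_const _
        refine (h1.cexp.mul (hq.2 z hz)).congr_deriv ?_
        rw [norm_mul, Complex.norm_exp_ofReal_mul_I, one_mul]
        ring
      · simp [h0]
      · simp [h1]
      · unfold effort
        have : ∀ z : ℝ, ‖Complex.exp (((s * (z * (L - z)) : ℝ) : ℂ) * Complex.I) *
            (n z + ((s * (L - 2 * z) : ℝ) : ℂ) * (Complex.I * q z))‖ ^ 2 =
            ‖n z‖ ^ 2 + s * ((L - 2 * z) * (2 * (n z * star (Complex.I * q z)).re)) +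
              s ^ 2 * ((L - 2 * z) ^ 2 * ‖q z‖ ^ 2) := by
          intro z
          rw [norm_mul, Complex.norm_exp_ofReal_mul_I, one_mul]
          simp only [← Complex.normSq_eq_norm_sq, Complex.normSq_apply, Complex.add_re,
            Complex.add_im, Complex.mul_re, Complex.mul_im, Complex.ofReal_re, Complex.ofReal_im,
            Complex.I_re, Complex.I_im, Complex.star_def, Complex.conj_re, Complex.conj_im]
          ring
        simp_rw [this]
        rw [intervalIntegral.integral_add, intervalIntegral.integral_add,
          intervalIntegral.integral_const_mul, intervalIntegral.integral_const_mul]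
        · rw [← he]; rfl
        · exact hI _ (by fun_prop)
        · exact hI _ (continuousOn_const.mul cB)
        · exact hI _ ((by fun_prop : ContinuousOn (fun z => ‖n z‖ ^ 2) (Icc 0 L)).add
            (continuousOn_const.mul cB))
        · exact hI _ (continuousOn_const.mul cA)
    have hp : Continuous fun s : ℝ => ε + s * B + s ^ 2 * A := by fun_prop
    obtain ⟨s₁, hs₁0, hs₁⟩ : ∃ s : ℝ, 0 ≤ s ∧ E ≤ ε + s * B + s ^ 2 * A := by
      refine ⟨(|B| + (E - ε) + A) / A, by have := abs_nonneg B; have := sub_nonneg.2 hε; positivity,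
        ?_⟩
      set t := (|B| + (E - ε) + A) / A with ht
      have htA : t * A = |B| + (E - ε) + A := by rw [ht]; field_simp
      have hb := abs_nonneg B
      have hb' := neg_abs_le B
      have ht1 : 1 ≤ t := by rw [ht, le_div_iff₀ hA]; linarith
      nlinarith [mul_nonneg (by linarith : (0 : ℝ) ≤ t) (by linarith : 0 ≤ B + |B|),
        mul_nonneg (by linarith : (0 : ℝ) ≤ t - 1) (by linarith : 0 ≤ E - ε)]
    obtain ⟨s, -, hs⟩ := intermediate_value_Icc hs₁0 hp.continuousOn
      (show E ∈ Icc _ _ from ⟨by simpa using hε, hs₁⟩)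
    exact (show ε + s * B + s ^ 2 * A = E from hs) ▸ key s
  · push Not at hcase
    have q0 : x = 0 := by
      have := hcase 0 ⟨le_rfl, hL.le⟩
      rw [h0] at this
      simpa [hL.ne'] using this
    have qL : y = 0 := by
      have := hcase L ⟨hL.le, le_rfl⟩
      rw [h1] at this
      have hLL : L - 2 * L ≠ 0 := by intro h; linarith
      simpa [hLL] using this
    set A : ℝ := ∫ z in (0 : ℝ)..L, (L - 2 * z) ^ 2
    set C : ℝ := ∫ z in (0 : ℝ)..L, γ ^ 2 * (z * (L - z)) ^ 6
    have hA : 0 < A := intervalIntegral.integral_pos hL (by fun_prop) (fun _ _ => by positivity)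
      ⟨0, ⟨le_rfl, hL.le⟩, by simp; positivity⟩
    have hC : 0 ≤ C := intervalIntegral.integral_nonneg hL.le (fun _ _ => by positivity)
    have key : ∀ s : ℝ, y ∈ reachExact γ L (s ^ 2 * A + s ^ 6 * C) x := by
      intro s
      refine ⟨fun z => ((s * (L - 2 * z) : ℝ) : ℂ) -
          Complex.I * γ * ((s * (z * (L - z)) : ℝ) : ℂ) ^ 3,
        fun z => ((s * (z * (L - z)) : ℝ) : ℂ), ⟨by fun_prop, ?_⟩, ?_, ?_, ?_⟩
      · intro z hz
        refine (((hφ z).const_mul s).ofReal_comp).congr_deriv ?_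
        have : ((‖((s * (z * (L - z)) : ℝ) : ℂ)‖ : ℝ) : ℂ) ^ 2 =
            ((s * (z * (L - z)) : ℝ) : ℂ) ^ 2 := by
          rw [Complex.norm_real, Real.norm_eq_abs, ← Complex.ofReal_pow, sq_abs,
            Complex.ofReal_pow]
        rw [this]
        ring
      · simp [q0]
      · simp [qL]
      · unfold effort
        have : ∀ z : ℝ, ‖((s * (L - 2 * z) : ℝ) : ℂ) -
            Complex.I * γ * ((s * (z * (L - z)) : ℝ) : ℂ) ^ 3‖ ^ 2 =
            s ^ 2 * (L - 2 * z) ^ 2 + s ^ 6 * (γ ^ 2 * (z * (L - z)) ^ 6) := by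
          intro z
          rw [← Complex.ofReal_pow, ← Complex.normSq_eq_norm_sq, Complex.normSq_apply]
          simp only [Complex.sub_re, Complex.sub_im, Complex.mul_re, Complex.mul_im,
            Complex.ofReal_re, Complex.ofReal_im, Complex.I_re, Complex.I_im]
          ring
        simp_rw [this]
        rw [intervalIntegral.integral_add (hI _ (by fun_prop)) (hI _ (by fun_prop)),
          intervalIntegral.integral_const_mul, intervalIntegral.integral_const_mul]
    have hp : Continuous fun s : ℝ => s ^ 2 * A + s ^ 6 * C := by fun_prop
    obtain ⟨s₁, hs₁0, hs₁⟩ : ∃ s : ℝ, 0 ≤ s ∧ E ≤ s ^ 2 * A + s ^ 6 * C := by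
      have hE0 : 0 ≤ E := hε0.trans hε
      refine ⟨Real.sqrt (E / A), Real.sqrt_nonneg _, ?_⟩
      have h2 : Real.sqrt (E / A) ^ 2 * A = E := by
        rw [Real.sq_sqrt (by positivity)]; field_simp
      have : 0 ≤ Real.sqrt (E / A) ^ 6 * C := by positivity
      linarith
    obtain ⟨s, -, hs⟩ := intermediate_value_Icc hs₁0 hp.continuousOn
      (show E ∈ Icc _ _ from ⟨by simpa using hε0.trans hε, hs₁⟩)
    exact (show s ^ 2 * A + s ^ 6 * C = E from hs) ▸ key s

theorem adversarialDistance_le {γ L : ℝ} (hL : 0 < L) {x₁ x₂ : ℂ} {n₁ q₁ n₂ q₂ : ℝ → ℂ}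
    (h : IsConfusingPair γ L x₁ x₂ n₁ q₁ n₂ q₂) :
    adversarialDistance γ L x₁ x₂ ≤ effort L n₁ := by
  refine csInf_le ⟨0, ?_⟩ ?_
  · rintro E ⟨y, hy, -⟩
    simp only [noiseBall, mem_iUnion] at hy
    obtain ⟨ε, hε, n, q, -, -, -, rfl⟩ := hy
    exact (effort_nonneg hL n).trans hε
  · refine ⟨q₁ L, ?_, ?_⟩ <;> simp only [noiseBall, mem_iUnion]
    · exact ⟨_, le_rfl, n₁, q₁, h.traj₁, h.start₁, rfl, rfl⟩
    · exact ⟨_, le_rfl, n₂, q₂, h.traj₂, h.start₂, h.same_output.symm, h.same_effort.symm⟩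

/-- Attaining `d(x₁, x₂)` is the same as being a minimizer of the equal-energy problem. -/
theorem isOptimalPair_iff {γ L : ℝ} (hL : 0 < L) {x₁ x₂ : ℂ} {q₁ q₂ : ℝ → ℂ} :
    IsOptimalPair γ L x₁ x₂ q₁ q₂ ↔
      ∃ n₁ n₂ : ℝ → ℂ, IsConfusingPair γ L x₁ x₂ n₁ q₁ n₂ q₂ ∧
        ∀ m₁ p₁ m₂ p₂ : ℝ → ℂ, IsConfusingPair γ L x₁ x₂ m₁ p₁ m₂ p₂ →
          effort L n₁ ≤ effort L m₁ := by
  constructor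
  · rintro ⟨n₁, n₂, h, he⟩
    exact ⟨n₁, n₂, h, fun _ _ _ _ h' => he ▸ adversarialDistance_le hL h'⟩
  · rintro ⟨n₁, n₂, h, hmin⟩
    refine ⟨n₁, n₂, h, le_antisymm ?_ (adversarialDistance_le hL h)⟩
    refine le_csInf ⟨effort L n₁, q₁ L, ?_, ?_⟩ ?_
    · simp only [noiseBall, mem_iUnion]
      exact ⟨_, le_rfl, n₁, q₁, h.traj₁, h.start₁, rfl, rfl⟩
    · simp only [noiseBall, mem_iUnion]
      exact ⟨_, le_rfl, n₂, q₂, h.traj₂, h.start₂, h.same_output.symm, h.same_effort.symm⟩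
    · rintro E ⟨y, hy₁, hy₂⟩
      simp only [noiseBall, mem_iUnion] at hy₁ hy₂
      obtain ⟨ε₁, hε₁, hy₁⟩ := hy₁
      obtain ⟨ε₂, hε₂, hy₂⟩ := hy₂
      obtain ⟨m₁, p₁, t₁, s₁, e₁, f₁⟩ := reachExact_inflate hL hε₁ hy₁
      obtain ⟨m₂, p₂, t₂, s₂, e₂, f₂⟩ := reachExact_inflate hL hε₂ hy₂
      exact f₁ ▸ hmin m₁ p₁ m₂ p₂ ⟨t₁, t₂, s₁, s₂, e₁.trans e₂.symm, f₁.trans f₂.symm⟩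

end

/-! Since `adversarialDistance` is defined with effort at most `E`, equality of the two efforts need
not be preserved by variations: an optimal pair merely cannot be perturbed so that both efforts drop
while the outputs still coincide (`adversarialDistance_le_max`). Perturb `q_k` to `q_k + s h_k` with
`h_k' = u_k`, `h_k(0) = 0` and `h_1(L) = h_2(L)`. Because the drift is polynomial, the new control
is explicit, and integration by parts writes half the first variation of the effort as the pairing
of `u_k` with `costate` (`integral_firstVariation`). The two pairings are never negative together,
so a combination with weights `1 - lam` and `lam` vanishes (`exists_convex_combination_eq_zero`); du
Bois-Reymond (`eq_const_of_pairing_eq_zero`) then makes the weighted costates constants `c` and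
`-c`. At `z = L` the costate is the control, which gives the transversality condition.

A constant costate with nonzero weight is the Euler–Lagrange equation in integrated form, and it
yields the missing regularity. If a weight is zero, its equation forces `c = 0`, so the other
control vanishes at `L`, hence everywhere by a Gronwall argument (`IsExtremal.eq_zero`); equal
efforts then make both controls zero. So both curves are always extremal and C², whatever `lam` is.
The function `c` of the theorem is the running difference of the efforts. -/

open scoped ComplexConjugate

/-! ### Multipliers for two functionals, and a du Bois-Reymond lemma -/

/-- Two linear functionals that are never simultaneously negative have a vanishing convex
combination. -/
theorem exists_convex_combination_eq_zero {V : Type*} [AddCommGroup V] [Module ℝ V]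
    (f g : V →ₗ[ℝ] ℝ) (h : ∀ v, f v < 0 → 0 ≤ g v) :
    ∃ lam : ℝ, ∀ v, (1 - lam) * f v + lam * g v = 0 := by
  by_cases hf : ∀ v, f v = 0
  · exact ⟨0, fun v => by simp [hf v]⟩
  push Not at hf
  obtain ⟨v₀, hv₀⟩ := hf
  obtain ⟨v, hv⟩ : ∃ v, f v = -1 :=
    ⟨(-(f v₀)⁻¹) • v₀, by rw [map_smul, smul_eq_mul]; field_simp⟩
  have hc : 0 ≤ g v := h v (by rw [hv]; norm_num)
  have hg : ∀ w, g w = -f w * g v := by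
    intro w
    by_contra hne
    have hne' : g w + f w * g v ≠ 0 := fun h0 => hne (by linarith)
    -- The direction `w + f w • v` lies in the kernel of `f` but not of `g`; sliding along it from
    -- `v` keeps `f = -1`, and this `t` brings `g` down to `-1`.
    set t : ℝ := -(g v + 1) / (g w + f w * g v)
    have ht : t * (g w + f w * g v) = -(g v + 1) := by simp only [t]; exact div_mul_cancel₀ _ hne'
    have h1 : f (v + t • (w + f w • v)) = -1 := by
      simp only [map_add, map_smul, smul_eq_mul, hv]; ring
    have h2 : g (v + t • (w + f w • v)) = -1 := by
      simp only [map_add, map_smul, smul_eq_mul, ht]; ring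
    have := h _ (by rw [h1]; norm_num)
    rw [h2] at this
    linarith
  -- As `g = -(g v) • f`, the multiplier must solve `1 - lam = lam * g v`.
  refine ⟨1 / (1 + g v), fun w => ?_⟩
  have : (1 + g v) ≠ 0 := by positivity
  rw [hg w]
  field_simp
  ring

/-- The real pairing `∫₀ᴸ Re (p̄ u)`. -/
noncomputable def realPairing (L : ℝ) (p : C(ℝ, ℂ)) : C(ℝ, ℂ) →ₗ[ℝ] ℝ where
  toFun u := ∫ z in (0 : ℝ)..L, (conj (p z) * u z).re
  map_add' u v := by
    rw [← intervalIntegral.integral_add]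
    · simp only [ContinuousMap.add_apply, mul_add, Complex.add_re]
    all_goals exact Continuous.intervalIntegrable (by fun_prop) _ _
  map_smul' c u := by
    rw [RingHom.id_apply, smul_eq_mul, ← intervalIntegral.integral_const_mul]
    refine intervalIntegral.integral_congr fun z _ => ?_
    simp only [ContinuousMap.smul_apply, Complex.real_smul, mul_left_comm _ (c : ℂ),
      Complex.re_ofReal_mul]

/-- The integral over `[0, L]` as a linear map on continuous functions. -/
noncomputable def integralMap (L : ℝ) : C(ℝ, ℂ) →ₗ[ℝ] ℂ where
  toFun u := ∫ z in (0 : ℝ)..L, u z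
  map_add' u v := intervalIntegral.integral_add
    (Continuous.intervalIntegrable (by fun_prop) _ _)
    (Continuous.intervalIntegrable (by fun_prop) _ _)
  map_smul' c u := intervalIntegral.integral_smul c _

theorem realPairing_const (L : ℝ) (c : ℂ) (u : C(ℝ, ℂ)) :
    realPairing L (ContinuousMap.const ℝ c) u = (conj c * integralMap L u).re := by
  have : (∫ z in (0 : ℝ)..L, (conj c * u z).re) = (∫ z in (0 : ℝ)..L, conj c * u z).re :=
    Complex.reCLM.intervalIntegral_comp_comm (f := fun z => conj c * u z)
      (Continuous.intervalIntegrable (by fun_prop) _ _)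
  rw [intervalIntegral.integral_const_mul] at this
  exact this

theorem realPairing_sub_left (L : ℝ) (p r u : C(ℝ, ℂ)) :
    realPairing L (p - r) u = realPairing L p u - realPairing L r u := by
  simp only [realPairing, LinearMap.coe_mk, AddHom.coe_mk]
  rw [← intervalIntegral.integral_sub]
  · simp only [ContinuousMap.sub_apply, map_sub, sub_mul, Complex.sub_re]
  all_goals exact Continuous.intervalIntegrable (by fun_prop) _ _

theorem realPairing_smul_left (L t : ℝ) (p u : C(ℝ, ℂ)) :
    realPairing L (t • p) u = t * realPairing L p u := by
  simp only [realPairing, LinearMap.coe_mk, AddHom.coe_mk]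
  rw [← intervalIntegral.integral_const_mul]
  refine intervalIntegral.integral_congr fun z _ => ?_
  simp only [ContinuousMap.smul_apply, Complex.real_smul, map_mul, Complex.conj_ofReal, mul_assoc,
    Complex.re_ofReal_mul]

theorem re_conj_mul_self (w : ℂ) : (conj w * w).re = ‖w‖ ^ 2 := by
  rw [← Complex.normSq_eq_conj_mul_self, Complex.ofReal_re, Complex.normSq_eq_norm_sq]

theorem realPairing_self_nonneg {L : ℝ} (hL : 0 < L) (p : C(ℝ, ℂ)) : 0 ≤ realPairing L p p :=
  intervalIntegral.integral_nonneg hL.le fun z _ => by rw [re_conj_mul_self]; positivity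

theorem eqOn_zero_of_integral_norm_sq_eq_zero {L : ℝ} (hL : 0 < L) {f : ℝ → ℂ}
    (hf : ContinuousOn f (Icc 0 L)) (h : ∫ z in (0 : ℝ)..L, ‖f z‖ ^ 2 = 0) :
    ∀ z ∈ Icc 0 L, f z = 0 := by
  intro z hz
  by_contra hne
  have : 0 < ∫ z in (0 : ℝ)..L, ‖f z‖ ^ 2 :=
    intervalIntegral.integral_pos hL (by fun_prop) (fun _ _ => by positivity)
      ⟨z, hz, by have := norm_pos_iff.2 hne; positivity⟩
  exact this.ne' h

theorem eqOn_zero_of_realPairing_self {L : ℝ} (hL : 0 < L) {p : C(ℝ, ℂ)}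
    (h : realPairing L p p = 0) : ∀ z ∈ Icc 0 L, p z = 0 := by
  refine eqOn_zero_of_integral_norm_sq_eq_zero hL p.continuous.continuousOn ?_
  refine Eq.trans ?_ h
  exact intervalIntegral.integral_congr fun z _ => (re_conj_mul_self (p z)).symm

/-- A du Bois-Reymond lemma for two curves with a common free end point. -/
theorem eq_const_of_pairing_eq_zero {L : ℝ} (hL : 0 < L) (r₁ r₂ : C(ℝ, ℂ))
    (h : ∀ u₁ u₂ : C(ℝ, ℂ), integralMap L u₁ = integralMap L u₂ →
      realPairing L r₁ u₁ + realPairing L r₂ u₂ = 0) :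
    ∃ c : ℂ, ∀ z ∈ Icc 0 L, r₁ z = c ∧ r₂ z = -c := by
  -- The value for which `r₁ - c` and `r₂ + c` have equal integrals, so that they are themselves
  -- admissible test functions.
  set c : ℂ := (integralMap L r₁ - integralMap L r₂) / (2 * L)
  have hint : ∀ c : ℂ, integralMap L (ContinuousMap.const ℝ c) = L * c := fun c => by
    simp [integralMap]
  have hL' : (L : ℂ) ≠ 0 := by exact_mod_cast hL.ne'
  have heq : integralMap L (r₁ - ContinuousMap.const ℝ c) =
      integralMap L (r₂ - ContinuousMap.const ℝ (-c)) := by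
    rw [map_sub, map_sub, hint, hint]
    simp only [c]
    field_simp
    ring
  have h0 := h _ _ heq
  have h1 : realPairing L (r₁ - ContinuousMap.const ℝ c) (r₁ - ContinuousMap.const ℝ c) +
      realPairing L (r₂ - ContinuousMap.const ℝ (-c)) (r₂ - ContinuousMap.const ℝ (-c)) = 0 := by
    -- The pairings with `c` and `-c` cancel because the two test functions have the same integral;
    -- a sum of two squared norms remains.
    rw [realPairing_sub_left, realPairing_sub_left, realPairing_const, realPairing_const, ← heq,
      map_neg, neg_mul, Complex.neg_re]
    linarith
  have p₁ := realPairing_self_nonneg hL (r₁ - ContinuousMap.const ℝ c)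
  have p₂ := realPairing_self_nonneg hL (r₂ - ContinuousMap.const ℝ (-c))
  have e₁ := eqOn_zero_of_realPairing_self hL (le_antisymm (by linarith) p₁)
  have e₂ := eqOn_zero_of_realPairing_self hL (le_antisymm (by linarith) p₂)
  exact ⟨c, fun z hz => ⟨sub_eq_zero.1 (e₁ z hz), sub_eq_zero.1 (e₂ z hz)⟩⟩

/-- The space `V` below consists of the velocity variations that move both end points equally. A
convex combination vanishing on `V` is exactly the hypothesis of the du Bois-Reymond lemma for the
weighted functions. -/
theorem exists_multiplier {L : ℝ} (hL : 0 < L) (p₁ p₂ : C(ℝ, ℂ))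
    (h : ∀ u₁ u₂ : C(ℝ, ℂ), integralMap L u₁ = integralMap L u₂ →
      realPairing L p₁ u₁ < 0 → 0 ≤ realPairing L p₂ u₂) :
    ∃ (lam : ℝ) (c : ℂ), ∀ z ∈ Icc 0 L, ((1 - lam : ℝ) : ℂ) * p₁ z = c ∧ (lam : ℂ) * p₂ z = -c := by
  let V : Submodule ℝ (C(ℝ, ℂ) × C(ℝ, ℂ)) := LinearMap.ker ((integralMap L).comp (LinearMap.fst ℝ C(ℝ, ℂ) C(ℝ, ℂ)) -
    (integralMap L).comp (LinearMap.snd ℝ C(ℝ, ℂ) C(ℝ, ℂ)))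
  obtain ⟨lam, hlam⟩ := exists_convex_combination_eq_zero (V := V)
    (((realPairing L p₁).comp (LinearMap.fst ℝ C(ℝ, ℂ) C(ℝ, ℂ))).domRestrict V)
    (((realPairing L p₂).comp (LinearMap.snd ℝ C(ℝ, ℂ) C(ℝ, ℂ))).domRestrict V)
    (fun ⟨v, hv⟩ => h v.1 v.2 (sub_eq_zero.1 hv))
  obtain ⟨c, hc⟩ := eq_const_of_pairing_eq_zero hL ((1 - lam) • p₁) (lam • p₂) (by
    intro u₁ u₂ hu
    rw [realPairing_smul_left, realPairing_smul_left]
    exact hlam ⟨(u₁, u₂), sub_eq_zero.2 hu⟩)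
  refine ⟨lam, c, fun z hz => ?_⟩
  simpa only [ContinuousMap.smul_apply, Complex.real_smul] using hc z hz

/-! ### The first variation of the effort -/

/-- The right-hand side `iγ (2 |q|² n - q² n̄)` of the Euler–Lagrange equation for the control. -/
noncomputable def adjointField (γ : ℝ) (q n : ℂ) : ℂ :=
  Complex.I * γ * (2 * (q * conj q) * n - q ^ 2 * conj n)

theorem continuous_adjointField (γ : ℝ) (N Q : C(ℝ, ℂ)) :
    Continuous fun z => adjointField γ (Q z) (N z) := by
  unfold adjointField; fun_prop

theorem hasDerivAt_primitive {f : ℝ → ℂ} (hf : Continuous f) (z : ℝ) :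
    HasDerivAt (fun z => ∫ t in (0 : ℝ)..z, f t) (f z) z :=
  intervalIntegral.integral_hasDerivAt_right (hf.intervalIntegrable _ _)
    hf.stronglyMeasurable.stronglyMeasurableAtFilter hf.continuousAt

theorem continuous_primitive_of_continuous {f : ℝ → ℂ} (hf : Continuous f) :
    Continuous fun z => ∫ t in (0 : ℝ)..z, f t :=
  continuous_iff_continuousAt.2 fun z => (hasDerivAt_primitive hf z).continuousAt

/-- The representing function `n(z) + ∫_z^L iγ (2 |q|² n - q² n̄)` of the first variation of the
effort, with respect to variations of `q'`. -/
noncomputable def costate (γ L : ℝ) (N Q : C(ℝ, ℂ)) : C(ℝ, ℂ) where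
  toFun z := N z + ((∫ t in (0 : ℝ)..L, adjointField γ (Q t) (N t)) -
    ∫ t in (0 : ℝ)..z, adjointField γ (Q t) (N t))
  continuous_toFun := N.continuous.add
    (continuous_const.sub (continuous_primitive_of_continuous (continuous_adjointField γ N Q)))

/-- The control of the perturbed curve `q + s h` with `h' = u` is `n + s` times this. -/
noncomputable def controlIncrement (γ s : ℝ) (q h u : ℂ) : ℂ :=
  u - Complex.I * γ * (2 * (q * conj q) * h + q ^ 2 * conj h +
    s * (2 * q * (h * conj h) + conj q * h ^ 2) + s ^ 2 * (h * conj h) * h)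

/-- `adjointField` is the real adjoint of the linearised drift, up to sign. Integrating by parts
against its tail integral `T` leaves no boundary term, since `h 0 = 0` and `T L = 0`; the end value
`h L` may thus stay free. -/
theorem integral_firstVariation (γ L : ℝ) (N Q u : C(ℝ, ℂ)) :
    ∫ z in (0 : ℝ)..L, (conj (N z) * controlIncrement γ 0 (Q z) (∫ t in (0 : ℝ)..z, u t) (u z)).re
      = realPairing L (costate γ L N Q) u := by
  have hm := continuous_adjointField γ N Q
  set T : ℝ → ℂ := fun z => (∫ t in (0 : ℝ)..L, adjointField γ (Q t) (N t)) -
    ∫ t in (0 : ℝ)..z, adjointField γ (Q t) (N t) with hT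
  set h : ℝ → ℂ := fun z => ∫ t in (0 : ℝ)..z, u t with hh
  have hTc : Continuous T := continuous_const.sub (continuous_primitive_of_continuous hm)
  have hhc : Continuous h := continuous_primitive_of_continuous u.continuous
  have dT : ∀ z, HasDerivAt T (-adjointField γ (Q z) (N z)) z := fun z =>
    (hasDerivAt_primitive hm z).const_sub _
  have dh : ∀ z, HasDerivAt h (u z) z := hasDerivAt_primitive u.continuous
  have dTh : ∀ z, HasDerivAt (fun z => (conj (T z) * h z).re)
      ((conj (T z) * u z).re - (conj (adjointField γ (Q z) (N z)) * h z).re) z := fun z => by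
    have h1 : HasDerivAt (fun z => conj (T z)) (conj (-adjointField γ (Q z) (N z))) z :=
      (dT z).star
    have h2 := Complex.reCLM.hasFDerivAt.comp_hasDerivAt z (h1.mul (dh z))
    refine h2.congr_deriv ?_
    simp only [Complex.reCLM_apply, map_neg, Complex.add_re, neg_mul, Complex.neg_re]
    ring
  have c1 : Continuous fun z => (conj (T z) * u z).re := by fun_prop
  have c2 : Continuous fun z => (conj (adjointField γ (Q z) (N z)) * h z).re := by fun_prop
  have c12 : Continuous fun z => (conj (T z) * u z).re -
      (conj (adjointField γ (Q z) (N z)) * h z).re := c1.sub c2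
  have key := intervalIntegral.integral_eq_sub_of_hasDerivAt (fun z _ => dTh z)
    (c12.intervalIntegrable 0 L)
  have e0 : h 0 = 0 := by simp [hh]
  have eL : T L = 0 := by simp [hT]
  rw [e0, eL, map_zero, zero_mul, mul_zero, sub_self] at key
  have e1 : ∀ z, (conj (N z) * controlIncrement γ 0 (Q z) (h z) (u z)).re =
      (conj (N z + T z) * u z).re -
        ((conj (T z) * u z).re - (conj (adjointField γ (Q z) (N z)) * h z).re) := fun z => by
    simp only [controlIncrement, adjointField, pow_two, map_mul, map_sub, map_add, Complex.conj_I,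
      Complex.conj_ofReal, Complex.conj_conj, map_ofNat, Complex.ofReal_zero,
      Complex.add_re, Complex.add_im, Complex.sub_re, Complex.sub_im, Complex.neg_re,
      Complex.neg_im, Complex.mul_re, Complex.mul_im, Complex.ofReal_re, Complex.ofReal_im,
      Complex.I_re, Complex.I_im, Complex.conj_re, Complex.conj_im, Complex.re_ofNat,
      Complex.im_ofNat, Complex.zero_re, Complex.zero_im]
    ring
  refine (intervalIntegral.integral_congr fun z _ => e1 z).trans ?_
  rw [intervalIntegral.integral_sub (Continuous.intervalIntegrable (by fun_prop) _ _)
    (c12.intervalIntegrable 0 L)]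
  rw [key, sub_zero]
  rfl

/-- The expansion of the cubic drift in `s` terminates, so the perturbed curve is an exact
trajectory for every `s`, not only to first order. -/
theorem controlIncrement_spec (γ s : ℝ) (q h u n : ℂ) :
    Complex.I * γ * (‖q + s * h‖ : ℂ) ^ 2 * (q + s * h) + (n + s * controlIncrement γ s q h u) =
      Complex.I * γ * (‖q‖ : ℂ) ^ 2 * q + n + s * u := by
  rw [← Complex.mul_conj', ← Complex.mul_conj', map_add, map_mul, Complex.conj_ofReal,
    controlIncrement]
  ring

theorem norm_add_smul_sq (n k : ℂ) (s : ℝ) :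
    ‖n + s * k‖ ^ 2 = ‖n‖ ^ 2 + s * (2 * (conj n * k).re + s * ‖k‖ ^ 2) := by
  simp only [← Complex.normSq_eq_norm_sq, Complex.normSq_apply, Complex.add_re, Complex.add_im,
    Complex.mul_re, Complex.mul_im, Complex.ofReal_re, Complex.ofReal_im, Complex.conj_re,
    Complex.conj_im]
  ring

/-- If the first variation of the effort is negative, then the effort decreases along the
perturbation. -/
theorem eventually_effort_lt {γ L : ℝ} (N Q u : C(ℝ, ℂ)) (hq : IsTrajectory γ L N Q)
    (hneg : realPairing L (costate γ L N Q) u < 0) :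
    ∀ᶠ s : ℝ in nhdsWithin 0 (Ioi 0), ∃ n : ℝ → ℂ,
      IsTrajectory γ L n (fun z => Q z + s * ∫ t in (0 : ℝ)..z, u t) ∧
        effort L n < effort L N := by
  set h : ℝ → ℂ := fun z => ∫ t in (0 : ℝ)..z, u t with hh
  have hhc : Continuous h := continuous_primitive_of_continuous u.continuous
  set K : ℝ → ℝ → ℂ := fun s z => controlIncrement γ s (Q z) (h z) (u z) with hK
  have hKc : Continuous (Function.uncurry K) := by
    simp only [hK, controlIncrement]; fun_prop
  have hKs : ∀ s, Continuous (K s) := fun s => hKc.comp (Continuous.prodMk_right s)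
  -- The pointwise difference quotient of the effort: the perturbed effort is the old one plus `s *
  -- ∫ G s`. Its integral is continuous in `s` and negative at `s = 0`.
  set G : ℝ → ℝ → ℝ := fun s z => 2 * (conj (N z) * K s z).re + s * ‖K s z‖ ^ 2 with hG
  have hGc : Continuous (Function.uncurry G) := by
    have : Function.uncurry G = fun p : ℝ × ℝ =>
      2 * (conj (N p.2) * Function.uncurry K p).re + p.1 * ‖Function.uncurry K p‖ ^ 2 := rfl
    rw [this]; fun_prop
  have hGs : ∀ s, Continuous (G s) := fun s => hGc.comp (Continuous.prodMk_right s)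
  have hI : Continuous fun s => ∫ z in (0 : ℝ)..L, G s z :=
    intervalIntegral.continuous_parametric_intervalIntegral_of_continuous' hGc 0 L
  have h0 : ∫ z in (0 : ℝ)..L, G 0 z < 0 := by
    have : ∫ z in (0 : ℝ)..L, G 0 z = 2 * realPairing L (costate γ L N Q) u := by
      rw [← integral_firstVariation, ← intervalIntegral.integral_const_mul]
      refine intervalIntegral.integral_congr fun z _ => ?_
      simp only [hG, hK, zero_mul, add_zero, hh]
    rw [this]; linarith
  have hev : ∀ᶠ s : ℝ in nhdsWithin 0 (Ioi 0), ∫ z in (0 : ℝ)..L, G s z < 0 :=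
    nhdsWithin_le_nhds (hI.continuousAt.eventually_lt_const h0)
  filter_upwards [hev, self_mem_nhdsWithin] with s hs hs0
  refine ⟨fun z => N z + s * K s z, ⟨?_, fun z hz => ?_⟩, ?_⟩
  · have := hKs s
    exact Continuous.continuousOn (by fun_prop)
  · rw [controlIncrement_spec]
    exact (hq.2 z hz).add ((hasDerivAt_primitive u.continuous z).hasDerivWithinAt.const_mul _)
  · simp only [effort, norm_add_smul_sq]
    have hGs' := hGs s
    simp only [hG] at hGs'
    rw [intervalIntegral.integral_add (Continuous.intervalIntegrable (by fun_prop) _ _)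
      (Continuous.intervalIntegrable (by fun_prop) _ _), intervalIntegral.integral_const_mul]
    have := mul_neg_of_pos_of_neg hs0 hs
    simp only [hG] at this
    linarith

/-! ### Optimality yields a multiplier -/

/-- The distance is at most the larger of two efforts that lead to a common output. -/
theorem adversarialDistance_le_max {γ L : ℝ} (hL : 0 < L) {n₁ q₁ n₂ q₂ : ℝ → ℂ}
    (h₁ : IsTrajectory γ L n₁ q₁) (h₂ : IsTrajectory γ L n₂ q₂) (h : q₁ L = q₂ L) :
    adversarialDistance γ L (q₁ 0) (q₂ 0) ≤ max (effort L n₁) (effort L n₂) := by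
  refine csInf_le ⟨0, ?_⟩ ⟨q₁ L, ?_, ?_⟩
  · rintro E ⟨y, hy, -⟩
    simp only [noiseBall, mem_iUnion] at hy
    obtain ⟨ε, hε, n, q, -, -, -, rfl⟩ := hy
    exact (effort_nonneg hL n).trans hε
  · simp only [noiseBall, mem_iUnion]
    exact ⟨_, le_max_left _ _, n₁, q₁, h₁, rfl, rfl, rfl⟩
  · simp only [noiseBall, mem_iUnion]
    exact ⟨_, le_max_right _ _, n₂, q₂, h₂, rfl, h.symm, rfl⟩

/-- If both first variations were negative, one small `s > 0` would lower both efforts below the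
distance, with equal outputs, contradicting the infimum. -/
theorem exists_multiplier_of_optimal {γ L : ℝ} (hL : 0 < L) {N₁ Q₁ N₂ Q₂ : C(ℝ, ℂ)}
    (h₁ : IsTrajectory γ L N₁ Q₁) (h₂ : IsTrajectory γ L N₂ Q₂) (h : Q₁ L = Q₂ L)
    (e₁ : effort L N₁ = adversarialDistance γ L (Q₁ 0) (Q₂ 0))
    (e₂ : effort L N₂ = adversarialDistance γ L (Q₁ 0) (Q₂ 0)) :
    ∃ (lam : ℝ) (c : ℂ), ∀ z ∈ Icc 0 L,
      ((1 - lam : ℝ) : ℂ) * costate γ L N₁ Q₁ z = c ∧ (lam : ℂ) * costate γ L N₂ Q₂ z = -c := by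
  refine exists_multiplier hL _ _ fun u₁ u₂ hu p₁ => ?_
  by_contra! p₂
  obtain ⟨s, ⟨n₁, t₁, l₁⟩, n₂, t₂, l₂⟩ :=
    ((eventually_effort_lt N₁ Q₁ u₁ h₁ p₁).and (eventually_effort_lt N₂ Q₂ u₂ h₂ p₂)).exists
  have hu' : ∫ t in (0 : ℝ)..L, u₁ t = ∫ t in (0 : ℝ)..L, u₂ t := hu
  have := adversarialDistance_le_max hL t₁ t₂ (by rw [h, hu'])
  simp only [intervalIntegral.integral_same, mul_zero, add_zero] at this
  exact absurd this (not_le.2 (max_lt (l₁.trans_eq e₁) (l₂.trans_eq e₂)))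

/-- A trajectory and its control agree on `[0, L]` with globally continuous ones. -/
theorem IsTrajectory.exists_continuous_extension {γ L : ℝ} (hL : 0 < L) {n q : ℝ → ℂ}
    (h : IsTrajectory γ L n q) :
    ∃ N Q : C(ℝ, ℂ), IsTrajectory γ L N Q ∧ EqOn n N (Icc 0 L) ∧ EqOn q Q (Icc 0 L) := by
  have ext : ∀ f : ℝ → ℂ, ContinuousOn f (Icc 0 L) → ∃ F : C(ℝ, ℂ), EqOn f F (Icc 0 L) :=
    fun f hf => ⟨⟨_, (continuousOn_iff_continuous_domRestrict.1 hf).Icc_extend' (h := hL.le)⟩,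
      fun z hz => (IccExtend_of_mem hL.le (domRestrict (Icc 0 L) f) hz).symm⟩
  obtain ⟨N, hN⟩ := ext n h.1
  obtain ⟨Q, hQ⟩ := ext q h.continuousOn
  refine ⟨N, Q, ⟨N.continuous.continuousOn, fun z hz => ?_⟩, hN, hQ⟩
  rw [← hN hz, ← hQ hz]
  exact (h.2 z hz).congr (fun y hy => (hQ hy).symm) (hQ hz).symm

theorem effort_congr {L : ℝ} (hL : 0 < L) {n m : ℝ → ℂ} (h : EqOn n m (Icc 0 L)) :
    effort L n = effort L m :=
  intervalIntegral.integral_congr fun z hz => by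
    rw [uIcc_of_le hL.le] at hz
    simp only [h hz]

/-! ### Extremals and the degenerate multipliers -/

/-- The control satisfies the Euler–Lagrange equation along the trajectory. -/
def IsExtremal (γ L : ℝ) (n q : ℝ → ℂ) : Prop :=
  ∀ z ∈ Icc 0 L, HasDerivWithinAt n (adjointField γ (q z) (n z)) (Icc 0 L) z

theorem IsExtremal.congr {γ L : ℝ} {n q N Q : ℝ → ℂ} (h : IsExtremal γ L N Q)
    (hn : EqOn n N (Icc 0 L)) (hq : EqOn q Q (Icc 0 L)) : IsExtremal γ L n q := fun z hz => by
  rw [hn hz, hq hz]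
  exact (h z hz).congr hn (hn hz)

theorem isExtremal_of_eqOn_zero {γ L : ℝ} {n q : ℝ → ℂ} (h : ∀ z ∈ Icc 0 L, n z = 0) :
    IsExtremal γ L n q := fun z hz => by
  rw [h z hz, adjointField, map_zero, mul_zero, mul_zero, sub_zero, mul_zero]
  exact (hasDerivWithinAt_const z _ 0).congr h (h z hz)

/-- Dividing by `t` exhibits the merely continuous control as a primitive of `adjointField` plus a
constant. -/
theorem isExtremal_of_costate_const {γ L : ℝ} {N Q : C(ℝ, ℂ)} {t c : ℂ} (ht : t ≠ 0)
    (h : ∀ z ∈ Icc 0 L, t * costate γ L N Q z = c) : IsExtremal γ L N Q := fun z hz => by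
  set C : ℂ := ∫ s in (0 : ℝ)..L, adjointField γ (Q s) (N s) with hC
  have hN : ∀ y ∈ Icc 0 L,
      N y = (∫ s in (0 : ℝ)..y, adjointField γ (Q s) (N s)) + (t⁻¹ * c - C) := fun y hy => by
    rw [← h y hy, inv_mul_cancel_left₀ ht]
    simp only [costate, ContinuousMap.coe_mk]
    ring
  exact (((hasDerivAt_primitive (continuous_adjointField γ N Q) z).add_const
    (t⁻¹ * c - C)).hasDerivWithinAt).congr hN (hN z hz)

theorem costate_right (γ L : ℝ) (N Q : C(ℝ, ℂ)) : costate γ L N Q L = N L := by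
  simp [costate]

theorem norm_adjointField_le (γ : ℝ) (q n : ℂ) :
    ‖adjointField γ q n‖ ≤ 3 * |γ| * ‖q‖ ^ 2 * ‖n‖ := by
  have : ‖2 * (q * conj q) * n - q ^ 2 * conj n‖ ≤ 3 * ‖q‖ ^ 2 * ‖n‖ := by
    refine (norm_sub_le _ _).trans_eq ?_
    simp only [norm_mul, norm_pow, Complex.norm_conj, Complex.norm_ofNat]
    ring
  rw [adjointField, norm_mul, norm_mul, Complex.norm_I, one_mul, Complex.norm_real,
    Real.norm_eq_abs]
  nlinarith [mul_le_mul_of_nonneg_left this (abs_nonneg γ)]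

/-- An extremal control that vanishes at the right end point vanishes identically. -/
theorem IsExtremal.eq_zero {γ L : ℝ} {n q : ℝ → ℂ} (h : IsExtremal γ L n q)
    (hq : ContinuousOn q (Icc 0 L)) (hn : n L = 0) : ∀ z ∈ Icc 0 L, n z = 0 := by
  obtain ⟨B, hB⟩ := isCompact_Icc.exists_bound_of_continuousOn hq
  set K : ℝ := 6 * |γ| * B ^ 2
  have hnc : ContinuousOn n (Icc 0 L) := fun z hz => (h z hz).continuousWithinAt
  -- Backward Gronwall: `|adjointField| ≤ 3|γ|B²|n|` gives `(|n|²)' ≥ -K|n|²`. The weighted square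
  -- is then nonnegative, nondecreasing and zero at `L`.
  have hmono : MonotoneOn (fun z => Real.exp (K * z) * (conj (n z) * n z).re) (Icc 0 L) := by
    refine monotoneOn_of_hasDerivWithinAt_nonneg (convex_Icc 0 L)
      (f' := fun z => Real.exp (K * z) * (K * ‖n z‖ ^ 2 +
        2 * (conj (n z) * adjointField γ (q z) (n z)).re)) ?_ ?_ ?_
    · have : ContinuousOn (fun z => (conj (n z) * n z).re) (Icc 0 L) :=
        Complex.continuous_re.comp_continuousOn
          ((Complex.continuous_conj.comp_continuousOn hnc).mul hnc)
      fun_prop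
    · intro z hz
      have hd := (h z (interior_subset hz)).mono (interior_subset (s := Icc (0 : ℝ) L))
      have h1 : HasDerivWithinAt (fun z => conj (n z)) (conj (adjointField γ (q z) (n z)))
          (interior (Icc 0 L)) z := hd.star
      have h2 := Complex.reCLM.hasFDerivAt.comp_hasDerivWithinAt z (h1.mul hd)
      have h3 : HasDerivWithinAt (fun z => Real.exp (K * z)) (Real.exp (K * z) * K)
          (interior (Icc 0 L)) z := by
        simpa using (((hasDerivAt_id z).const_mul K).exp).hasDerivWithinAt
      refine (h3.mul h2).congr_deriv ?_
      simp only [Function.comp_apply, Pi.mul_apply, Complex.reCLM_apply, ← re_conj_mul_self,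
        Complex.add_re, Complex.mul_re, Complex.conj_re, Complex.conj_im]
      ring
    · intro z hz
      have hb := hB z (interior_subset hz)
      have h1 := norm_adjointField_le γ (q z) (n z)
      have h2 : ‖q z‖ ^ 2 ≤ B ^ 2 := pow_le_pow_left₀ (norm_nonneg _) hb 2
      have h3 : ‖adjointField γ (q z) (n z)‖ ≤ 3 * |γ| * B ^ 2 * ‖n z‖ :=
        h1.trans (by gcongr)
      have h4 := (abs_le.1 ((Complex.abs_re_le_norm
        (conj (n z) * adjointField γ (q z) (n z))))).1
      rw [norm_mul, Complex.norm_conj] at h4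
      have h5 := mul_le_mul_of_nonneg_left h3 (norm_nonneg (n z))
      have h6 : K * ‖n z‖ ^ 2 = 2 * (‖n z‖ * (3 * |γ| * B ^ 2 * ‖n z‖)) := by
        simp only [K]; ring
      exact mul_nonneg (Real.exp_pos _).le (by linarith)
  intro z hz
  have h0 := hmono hz (right_mem_Icc.2 (hz.1.trans hz.2)) hz.2
  simp only [hn, mul_zero, Complex.zero_re, re_conj_mul_self] at h0
  have h1 : ‖n z‖ ^ 2 ≤ 0 := le_of_mul_le_mul_left (by simpa using h0) (Real.exp_pos (K * z))
  exact norm_eq_zero.1 (pow_eq_zero_iff two_ne_zero |>.1 (le_antisymm h1 (by positivity)))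

theorem eqOn_zero_of_effort_eq {L : ℝ} (hL : 0 < L) {n m : ℝ → ℂ}
    (hm : ContinuousOn m (Icc 0 L)) (hn : ∀ z ∈ Icc 0 L, n z = 0)
    (h : effort L n = effort L m) : ∀ z ∈ Icc 0 L, m z = 0 := by
  refine eqOn_zero_of_integral_norm_sq_eq_zero hL hm (h.symm.trans ?_)
  rw [effort_congr hL (m := 0) hn]
  simp [effort]

/-- Optimal pairs consist of extremals, and satisfy a transversality condition. -/
theorem exists_multiplier_isExtremal {γ L : ℝ} (hL : 0 < L) {x₁ x₂ : ℂ} {n₁ q₁ n₂ q₂ : ℝ → ℂ}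
    (h : IsConfusingPair γ L x₁ x₂ n₁ q₁ n₂ q₂)
    (he : effort L n₁ = adversarialDistance γ L x₁ x₂) :
    ∃ lam : ℝ, IsExtremal γ L n₁ q₁ ∧ IsExtremal γ L n₂ q₂ ∧
      ((1 - lam : ℝ) : ℂ) * n₁ L + (lam : ℂ) * n₂ L = 0 := by
  have h0 : (0 : ℝ) ∈ Icc 0 L := left_mem_Icc.2 hL.le
  have hLL : L ∈ Icc 0 L := right_mem_Icc.2 hL.le
  obtain ⟨N₁, Q₁, t₁, hn₁, hq₁⟩ := h.traj₁.exists_continuous_extension hL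
  obtain ⟨N₂, Q₂, t₂, hn₂, hq₂⟩ := h.traj₂.exists_continuous_extension hL
  have e₁ : effort L N₁ = adversarialDistance γ L (Q₁ 0) (Q₂ 0) := by
    rw [← effort_congr hL hn₁, ← hq₁ h0, ← hq₂ h0, h.start₁, h.start₂, he]
  have e₁₂ : effort L N₁ = effort L N₂ := by
    rw [← effort_congr hL hn₁, ← effort_congr hL hn₂, h.same_effort]
  obtain ⟨lam, c, hc⟩ := exists_multiplier_of_optimal hL t₁ t₂
    (by rw [← hq₁ hLL, ← hq₂ hLL, h.same_output]) e₁ (e₁₂ ▸ e₁)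
  have hcL := hc L hLL
  rw [costate_right, costate_right] at hcL
  suffices hex : IsExtremal γ L N₁ Q₁ ∧ IsExtremal γ L N₂ Q₂ by
    refine ⟨lam, hex.1.congr hn₁ hq₁, hex.2.congr hn₂ hq₂, ?_⟩
    rw [hn₁ hLL, hn₂ hLL, hcL.1, hcL.2, add_neg_cancel]
  -- For `lam = 0` the second costate carries no information. Its equation gives `c = 0`, so `N₁ L =
  -- 0`, hence `N₁ = 0` on the interval and, by equal efforts, `N₂ = 0` there. The case `lam = 1` is
  -- symmetric.
  by_cases hl0 : lam = 0
  · subst hl0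
    have hx : IsExtremal γ L N₁ Q₁ :=
      isExtremal_of_costate_const (by norm_num) fun z hz => (hc z hz).1
    have hz := hx.eq_zero Q₁.continuous.continuousOn (by
      have h1 := hcL.1
      have h2 := hcL.2
      rw [Complex.ofReal_zero, zero_mul, zero_eq_neg] at h2
      simpa [h2] using h1)
    exact ⟨hx, isExtremal_of_eqOn_zero
      (eqOn_zero_of_effort_eq hL N₂.continuous.continuousOn hz e₁₂)⟩
  · have hx : IsExtremal γ L N₂ Q₂ :=
      isExtremal_of_costate_const (Complex.ofReal_ne_zero.2 hl0) fun z hz => (hc z hz).2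
    refine ⟨?_, hx⟩
    by_cases hl1 : lam = 1
    · subst hl1
      have hz := hx.eq_zero Q₂.continuous.continuousOn (by
        have h1 := hcL.1
        have h2 := hcL.2
        rw [sub_self, Complex.ofReal_zero, zero_mul] at h1
        simpa [← h1] using h2)
      exact isExtremal_of_eqOn_zero
        (eqOn_zero_of_effort_eq hL N₁.continuous.continuousOn hz e₁₂.symm)
    · exact isExtremal_of_costate_const
        (Complex.ofReal_ne_zero.2 (sub_ne_zero.2 (Ne.symm hl1))) fun z hz => (hc z hz).1

/-! ### Real coordinates and conclusion -/

theorem contDiffOn_two_of_hasDerivWithinAt {L : ℝ} (hL : 0 < L) {f f' f'' : ℝ → ℝ}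
    (h₁ : ∀ z ∈ Icc 0 L, HasDerivWithinAt f (f' z) (Icc 0 L) z)
    (h₂ : ∀ z ∈ Icc 0 L, HasDerivWithinAt f' (f'' z) (Icc 0 L) z)
    (hc : ContinuousOn f'' (Icc 0 L)) :
    ContDiffOn ℝ 2 f (Icc 0 L) ∧ (∀ z ∈ Icc 0 L, segDeriv L f z = f' z) ∧
      ∀ z ∈ Icc 0 L, segDeriv L (segDeriv L f) z = f'' z := by
  have hu := uniqueDiffOn_Icc hL
  have d₁ : ∀ z ∈ Icc 0 L, derivWithin f (Icc 0 L) z = f' z := fun z hz =>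
    (h₁ z hz).derivWithin (hu z hz)
  have d₂ : ∀ z ∈ Icc 0 L, derivWithin f' (Icc 0 L) z = f'' z := fun z hz =>
    (h₂ z hz).derivWithin (hu z hz)
  refine ⟨?_, d₁, fun z hz => ?_⟩
  · have c₁ : ContDiffOn ℝ 1 f' (Icc 0 L) :=
      (contDiffOn_one_iff_derivWithin hu).2
        ⟨fun z hz => (h₂ z hz).differentiableWithinAt, hc.congr d₂⟩
    rw [show (2 : WithTop ℕ∞) = 1 + 1 from one_add_one_eq_two.symm,
      contDiffOn_succ_iff_derivWithin hu]
    exact ⟨fun z hz => (h₁ z hz).differentiableWithinAt, by simp, c₁.congr d₁⟩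
  · exact (derivWithin_congr d₁ (d₁ z hz)).trans (d₂ z hz)

theorem HasDerivWithinAt.complex_re {f : ℝ → ℂ} {f' : ℂ} {s : Set ℝ} {z : ℝ}
    (h : HasDerivWithinAt f f' s z) : HasDerivWithinAt (fun z => (f z).re) f'.re s z :=
  Complex.reCLM.hasFDerivAt.comp_hasDerivWithinAt z h

theorem HasDerivWithinAt.complex_im {f : ℝ → ℂ} {f' : ℂ} {s : Set ℝ} {z : ℝ}
    (h : HasDerivWithinAt f f' s z) : HasDerivWithinAt (fun z => (f z).im) f'.im s z :=
  Complex.imCLM.hasFDerivAt.comp_hasDerivWithinAt z h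

/-- The Euler–Lagrange equations of an extremal in real coordinates. -/
theorem IsExtremal.real_equations {γ L : ℝ} (hL : 0 < L) {n : ℝ → ℂ} {a b : ℝ → ℝ}
    (ht : IsTrajectory γ L n fun z => (a z : ℂ) + Complex.I * b z)
    (h : IsExtremal γ L n fun z => (a z : ℂ) + Complex.I * b z) :
    ContDiffOn ℝ 2 a (Icc 0 L) ∧ ContDiffOn ℝ 2 b (Icc 0 L) ∧ ∀ z ∈ Icc 0 L,
      segDeriv L a z = (n z).re - γ * b z * (a z ^ 2 + b z ^ 2) ∧
      segDeriv L b z = (n z).im + γ * a z * (a z ^ 2 + b z ^ 2) ∧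
      -4 * γ * segDeriv L b z * (a z ^ 2 + b z ^ 2)
          + 3 * γ ^ 2 * a z * (a z ^ 2 + b z ^ 2) ^ 2 - segDeriv L (segDeriv L a) z = 0 ∧
      4 * γ * segDeriv L a z * (a z ^ 2 + b z ^ 2)
          + 3 * γ ^ 2 * b z * (a z ^ 2 + b z ^ 2) ^ 2 - segDeriv L (segDeriv L b) z = 0 ∧
      effortDensity γ (a z) (b z) (segDeriv L a z) (segDeriv L b z) = ‖n z‖ ^ 2 := by
  set α : ℝ → ℝ := fun z => (n z).re with hα
  set β : ℝ → ℝ := fun z => (n z).im with hβ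
  have hnorm : ∀ z, (‖(a z : ℂ) + Complex.I * b z‖ : ℂ) ^ 2 = ((a z ^ 2 + b z ^ 2 : ℝ) : ℂ) := by
    intro z
    rw [← Complex.ofReal_pow, ← Complex.normSq_eq_norm_sq, Complex.normSq_apply]
    congr 1
    simp
    ring
  have da : ∀ z ∈ Icc 0 L,
      HasDerivWithinAt a (α z - γ * b z * (a z ^ 2 + b z ^ 2)) (Icc 0 L) z := fun z hz => by
    have := (ht.2 z hz).complex_re
    rw [hnorm] at this
    simp only [Complex.add_re, Complex.mul_re, Complex.mul_im, Complex.add_im, Complex.ofReal_re,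
      Complex.ofReal_im, Complex.I_re, Complex.I_im] at this
    convert this using 1
    · ext; ring
    · simp only [hα]; ring
  have db : ∀ z ∈ Icc 0 L,
      HasDerivWithinAt b (β z + γ * a z * (a z ^ 2 + b z ^ 2)) (Icc 0 L) z := fun z hz => by
    have := (ht.2 z hz).complex_im
    rw [hnorm] at this
    simp only [Complex.add_re, Complex.mul_re, Complex.mul_im, Complex.add_im, Complex.ofReal_re,
      Complex.ofReal_im, Complex.I_re, Complex.I_im] at this
    convert this using 1
    · ext; ring
    · simp only [hβ]; ring
  have dα : ∀ z ∈ Icc 0 L, HasDerivWithinAt α (-γ * (2 * (a z ^ 2 + b z ^ 2) * β z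
      - 2 * a z * b z * α z + (a z ^ 2 - b z ^ 2) * β z)) (Icc 0 L) z := fun z hz => by
    refine (h z hz).complex_re.congr_deriv ?_
    simp only [adjointField, pow_two, map_add, map_mul, Complex.conj_I, Complex.conj_ofReal,
      Complex.add_re, Complex.mul_re, Complex.mul_im, Complex.add_im, Complex.sub_re,
      Complex.sub_im, Complex.neg_re, Complex.neg_im, Complex.conj_re, Complex.conj_im,
      Complex.ofReal_re, Complex.ofReal_im, Complex.I_re, Complex.I_im, Complex.re_ofNat,
      Complex.im_ofNat, hα, hβ]
    ring
  have dβ : ∀ z ∈ Icc 0 L, HasDerivWithinAt β (γ * (2 * (a z ^ 2 + b z ^ 2) * α z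
      - (a z ^ 2 - b z ^ 2) * α z - 2 * a z * b z * β z)) (Icc 0 L) z := fun z hz => by
    refine (h z hz).complex_im.congr_deriv ?_
    simp only [adjointField, pow_two, map_add, map_mul, Complex.conj_I, Complex.conj_ofReal,
      Complex.add_re, Complex.mul_re, Complex.mul_im, Complex.add_im, Complex.sub_re,
      Complex.sub_im, Complex.neg_re, Complex.neg_im, Complex.conj_re, Complex.conj_im,
      Complex.ofReal_re, Complex.ofReal_im, Complex.I_re, Complex.I_im, Complex.re_ofNat,
      Complex.im_ofNat, hα, hβ]
    ring
  have ca : ContinuousOn a (Icc 0 L) := fun z hz => (da z hz).continuousWithinAt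
  have cb : ContinuousOn b (Icc 0 L) := fun z hz => (db z hz).continuousWithinAt
  have cα : ContinuousOn α (Icc 0 L) := fun z hz => (dα z hz).continuousWithinAt
  have cβ : ContinuousOn β (Icc 0 L) := fun z hz => (dβ z hz).continuousWithinAt
  -- Differentiating `a'` once more leaves `α` and `β`; the terms in `α` cancel and `β` is absorbed
  -- in `b' = β + γ a (a² + b²)`, which produces the second-order equation.
  have dda : ∀ z ∈ Icc 0 L, HasDerivWithinAt (fun z => α z - γ * b z * (a z ^ 2 + b z ^ 2))
      (-4 * γ * (β z + γ * a z * (a z ^ 2 + b z ^ 2)) * (a z ^ 2 + b z ^ 2)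
        + 3 * γ ^ 2 * a z * (a z ^ 2 + b z ^ 2) ^ 2) (Icc 0 L) z := fun z hz => by
    refine ((dα z hz).sub (((db z hz).const_mul γ).mul
      (((da z hz).pow 2).add ((db z hz).pow 2)))).congr_deriv ?_
    simp only [Pi.add_apply, Pi.pow_apply, Nat.cast_ofNat, Nat.add_one_sub_one, pow_one]
    ring
  have ddb : ∀ z ∈ Icc 0 L, HasDerivWithinAt (fun z => β z + γ * a z * (a z ^ 2 + b z ^ 2))
      (4 * γ * (α z - γ * b z * (a z ^ 2 + b z ^ 2)) * (a z ^ 2 + b z ^ 2)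
        + 3 * γ ^ 2 * b z * (a z ^ 2 + b z ^ 2) ^ 2) (Icc 0 L) z := fun z hz => by
    refine ((dβ z hz).add (((da z hz).const_mul γ).mul
      (((da z hz).pow 2).add ((db z hz).pow 2)))).congr_deriv ?_
    simp only [Pi.add_apply, Pi.pow_apply, Nat.cast_ofNat, Nat.add_one_sub_one, pow_one]
    ring
  obtain ⟨A, A₁, A₂⟩ := contDiffOn_two_of_hasDerivWithinAt hL da dda (by fun_prop)
  obtain ⟨B, B₁, B₂⟩ := contDiffOn_two_of_hasDerivWithinAt hL db ddb (by fun_prop)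
  refine ⟨A, B, fun z hz => ⟨A₁ z hz, B₁ z hz, ?_, ?_, ?_⟩⟩
  · rw [A₂ z hz, B₁ z hz, sub_self]
  · rw [B₂ z hz, A₁ z hz, sub_self]
  · rw [A₁ z hz, B₁ z hz, effortDensity]
    congr 2
    simp only [hα, hβ]
    apply Complex.ext <;>
    · simp only [pow_two, Complex.add_re, Complex.mul_re, Complex.mul_im, Complex.add_im,
        Complex.sub_re, Complex.sub_im, Complex.ofReal_re, Complex.ofReal_im, Complex.I_re,
        Complex.I_im]
      ring

theorem mainTheorem1 (γ L : ℝ) (hL : 0 < L) (x₁ x₂ : ℂ) (a₁ b₁ a₂ b₂ : ℝ → ℝ)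
    (hopt : IsOptimalPair γ L x₁ x₂
      (fun z => (a₁ z : ℂ) + Complex.I * b₁ z) (fun z => (a₂ z : ℂ) + Complex.I * b₂ z)) :
    -- the optimal trajectories are twice continuously differentiable
    (ContDiffOn ℝ 2 a₁ (Set.Icc 0 L) ∧ ContDiffOn ℝ 2 b₁ (Set.Icc 0 L) ∧
      ContDiffOn ℝ 2 a₂ (Set.Icc 0 L) ∧ ContDiffOn ℝ 2 b₂ (Set.Icc 0 L)) ∧
    ∃ (lam : ℝ) (c : ℝ → ℝ),
      -- differential equations
      (∀ z ∈ Set.Icc 0 L,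
        (1 - lam) * (-4 * γ * segDeriv L b₁ z * (a₁ z ^ 2 + b₁ z ^ 2)
          + 3 * γ ^ 2 * a₁ z * (a₁ z ^ 2 + b₁ z ^ 2) ^ 2 - segDeriv L (segDeriv L a₁) z) = 0 ∧
        (1 - lam) * (4 * γ * segDeriv L a₁ z * (a₁ z ^ 2 + b₁ z ^ 2)
          + 3 * γ ^ 2 * b₁ z * (a₁ z ^ 2 + b₁ z ^ 2) ^ 2 - segDeriv L (segDeriv L b₁) z) = 0 ∧
        lam * (-4 * γ * segDeriv L b₂ z * (a₂ z ^ 2 + b₂ z ^ 2)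
          + 3 * γ ^ 2 * a₂ z * (a₂ z ^ 2 + b₂ z ^ 2) ^ 2 - segDeriv L (segDeriv L a₂) z) = 0 ∧
        lam * (4 * γ * segDeriv L a₂ z * (a₂ z ^ 2 + b₂ z ^ 2)
          + 3 * γ ^ 2 * b₂ z * (a₂ z ^ 2 + b₂ z ^ 2) ^ 2 - segDeriv L (segDeriv L b₂) z) = 0 ∧
        DifferentiableWithinAt ℝ c (Set.Icc 0 L) z ∧
        segDeriv L c z + effortDensity γ (a₁ z) (b₁ z) (segDeriv L a₁ z) (segDeriv L b₁ z)
          - effortDensity γ (a₂ z) (b₂ z) (segDeriv L a₂ z) (segDeriv L b₂ z) = 0) ∧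
      -- boundary conditions at `z = 0`
      (a₁ 0 : ℂ) + Complex.I * b₁ 0 = x₁ ∧ (a₂ 0 : ℂ) + Complex.I * b₂ 0 = x₂ ∧ c 0 = 0 ∧
      -- boundary conditions at `z = L`
      c L = 0 ∧ (a₁ L : ℂ) + Complex.I * b₁ L = (a₂ L : ℂ) + Complex.I * b₂ L ∧
      (1 - lam) * segDeriv L a₁ L + lam * segDeriv L a₂ L + γ * b₁ L * (a₁ L ^ 2 + b₁ L ^ 2) = 0 ∧
      (1 - lam) * segDeriv L b₁ L + lam * segDeriv L b₂ L - γ * a₁ L * (a₁ L ^ 2 + b₁ L ^ 2) = 0 := by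
  obtain ⟨n₁, n₂, h, he⟩ := hopt
  obtain ⟨lam, hx₁, hx₂, htr⟩ := exists_multiplier_isExtremal hL h he
  obtain ⟨A₁, B₁, E₁⟩ := hx₁.real_equations hL h.traj₁
  obtain ⟨A₂, B₂, E₂⟩ := hx₂.real_equations hL h.traj₂
  -- With globally continuous controls the effort difference below is differentiable at every real
  -- point, the end points included.
  obtain ⟨N₁, -, -, hn₁, -⟩ := h.traj₁.exists_continuous_extension hL
  obtain ⟨N₂, -, -, hn₂, -⟩ := h.traj₂.exists_continuous_extension hL
  have hLL : L ∈ Set.Icc 0 L := Set.right_mem_Icc.2 hL.le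
  have c₁ : Continuous fun t => ‖N₁ t‖ ^ 2 := by fun_prop
  have c₂ : Continuous fun t => ‖N₂ t‖ ^ 2 := by fun_prop
  have cN : Continuous fun t => ‖N₂ t‖ ^ 2 - ‖N₁ t‖ ^ 2 := c₂.sub c₁
  have dc : ∀ z, HasDerivAt (fun z => ∫ t in (0 : ℝ)..z, (‖N₂ t‖ ^ 2 - ‖N₁ t‖ ^ 2))
      (‖N₂ z‖ ^ 2 - ‖N₁ z‖ ^ 2) z := fun z =>
    intervalIntegral.integral_hasDerivAt_right (cN.intervalIntegrable _ _)
      cN.stronglyMeasurable.stronglyMeasurableAtFilter cN.continuousAt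
  have hre := congrArg Complex.re htr
  have him := congrArg Complex.im htr
  rw [Complex.add_re, Complex.re_ofReal_mul, Complex.re_ofReal_mul, Complex.zero_re] at hre
  rw [Complex.add_im, Complex.im_ofReal_mul, Complex.im_ofReal_mul, Complex.zero_im] at him
  have hab : (a₁ L : ℂ) + Complex.I * b₁ L = (a₂ L : ℂ) + Complex.I * b₂ L := h.same_output
  have ha : a₁ L = a₂ L := by simpa using congrArg Complex.re hab
  have hb : b₁ L = b₂ L := by simpa using congrArg Complex.im hab
  obtain ⟨p₁, r₁, -⟩ := E₁ L hLL
  obtain ⟨p₂, r₂, -⟩ := E₂ L hLL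
  refine ⟨⟨A₁, B₁, A₂, B₂⟩, lam, fun z => ∫ t in (0 : ℝ)..z, (‖N₂ t‖ ^ 2 - ‖N₁ t‖ ^ 2),
    fun z hz => ?_, h.start₁, h.start₂, intervalIntegral.integral_same, ?_, hab, ?_, ?_⟩
  · obtain ⟨-, -, u₁, v₁, w₁⟩ := E₁ z hz
    obtain ⟨-, -, u₂, v₂, w₂⟩ := E₂ z hz
    refine ⟨by rw [u₁, mul_zero], by rw [v₁, mul_zero], by rw [u₂, mul_zero],
      by rw [v₂, mul_zero], (dc z).differentiableAt.differentiableWithinAt, ?_⟩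
    rw [w₁, w₂, segDeriv, (dc z).hasDerivWithinAt.derivWithin (uniqueDiffOn_Icc hL z hz), hn₁ hz,
      hn₂ hz]
    ring
  · have e := h.same_effort
    rw [effort_congr hL hn₁, effort_congr hL hn₂] at e
    exact (intervalIntegral.integral_sub (c₂.intervalIntegrable _ _)
      (c₁.intervalIntegrable _ _)).trans (sub_eq_zero.2 e.symm)
  -- At `L` each velocity is the control plus the drift at the common end point. The weights sum to
  -- `1`, so the drift appears once and the control terms vanish by transversality.
  · rw [p₁, p₂, ← ha, ← hb]
    linear_combination hre
  · rw [r₁, r₂, ← ha, ← hb]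
    linear_combination him
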